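/- **Theorem (generalized van Lambalgen theorem).** Let $\mu$ be any Borel probability measure on Cantor space $2^\omega$ (not necessarily computable) and let $A,B\in 2^\omega$. Then $$(A,B)\in \mathrm{MLR}_{\mu\times\mu}\iff A\in \mathrm{MLR}_\mu\ \text{ and }\ B\in\mathrm{MLR}_\mu(A).$$ Here the notions are as follows. The basic clopen sets of $2^\omega$ are the cylinders $[\sigma]$, $\sigma\in 2^{<\omega}$, and those of $2^\omega\times 2^\omega$ are the sets $[\sigma]\times[\tau]$. Let $\nu$ be a Borel probability measure on $E=2^\omega$ or $E=2^\omega\times 2^\omega$. * A *representation* of $\nu$ is a real $R\in 2^\omega$ that codes a fast converging sequence of rational approximations to the measures of the basic clopen sets: fixing a computable injective coding of the triples $(C,n,i)$ by natural numbers, where $C$ is a basic clopen set and $n,i\in\mathbb N$, it is required for all $C$ and $n$ that $\bigl|2^{-n}\cdot\#\{i<2^n : R(\langle C,n,i\rangle)=1\}-\nu(C)\bigr|\le 2^{-n}$. * For $Z\in 2^\omega$, classes $V_n\subseteq E$ $(n\in\mathbb N)$ are *uniformly $\Sigma^0_1(Z)$* if there is a recursively enumerable set $W$ such that, for all $n$,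 $V_n=\bigcup\{C : (n,C,\tau)\in W \text{ for some finite initial segment } \tau\prec Z\}$. * For $R,A\in 2^\omega$, an *$(R,A)$-test* is a sequence $(V_n)$ of uniformly $\Sigma^0_1(R\oplus A)$ classes $V_n\subseteq E$ with $\nu(V_n)\le 2^{-n}$ for all $n$. A point $x\in E$ is *$(R,A)$-random* if $x\notin\bigcap_n V_n$ for every $(R,A)$-test $(V_n)$. * $\mathrm{MLR}_\nu(A)$ is the set of all $x\in E$ that are $(R,A)$-random for some representation $R$ of $\nu$, and $\mathrm{MLR}_\nu=\mathrm{MLR}_\nu(\emptyset)$. In particular, the three memberships above do not depend on a choice of one representation: the representations that witness them may be different. -/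

import Mathlib

open MeasureTheory
open scoped ENNReal

namespace MLRandom

/-- Cantor space `2^ω`, with Mathlib's product topology and product (= Borel) σ-algebra. Its
elements are called reals and are identified with subsets of `ℕ`. -/
abbrev Cantor : Type := ℕ → Bool

/-- `σ ≺ X`: the finite binary string `σ` is an initial segment of the real `X`. -/
def IsInitSeg (σ : List Bool) (X : Cantor) : Prop :=
  ∀ (i : ℕ) (h : i < σ.length), X i = σ[i]

/-- The basic clopen set `[σ] ⊆ 2^ω`. -/
def cyl (σ : List Bool) : Set Cantor := {X | IsInitSeg σ X}

/-- The basic clopen set `[σ] × [τ] ⊆ 2^ω × 2^ω`. -/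
def cyl₂ (p : List Bool × List Bool) : Set (Cantor × Cantor) :=
  cyl p.1 ×ˢ cyl p.2

/-- The join `X ⊕ Y`, which has `X` on the even and `Y` on the odd positions. -/
def join (X Y : Cantor) : Cantor := fun n => if n % 2 = 0 then X (n / 2) else Y (n / 2)

/-- The empty set, as a real. -/
def emptyReal : Cantor := fun _ => false

section

/- The notions below are needed on `2^ω` and on `2^ω × 2^ω`. They are given for a space `E` with
a countable family `B` of basic open sets with indices in `ι`; the cases of interest are
`cyl` and `cyl₂`. -/
variable {E ι : Type} [Primcodable ι]

/-- The sequence `V` consists of uniformly `Σ⁰₁(Z)` classes: it is the section at the real `Z` of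
a `Σ⁰₁` subset of `ℕ × E × 2^ω`. That is, for a single recursively enumerable set `W` that does
not depend on the oracle, the basic set `B c` is enumerated into `V n` as soon as `(n, c, τ)` is
enumerated into `W` for some finite part `τ ≺ Z` of the oracle. -/
def UniformlySigma01 (B : ι → Set E) (Z : Cantor) (V : ℕ → Set E) : Prop :=
  ∃ W : ℕ × ι × List Bool → Prop, REPred W ∧
    ∀ n, V n = {x | ∃ c τ, W (n, c, τ) ∧ IsInitSeg τ Z ∧ x ∈ B c}

/-- The `n`-th rational approximation that the real `R` provides for the measure of `B c`: the
proportion of ones in a block of `2 ^ n` bits of `R` that is reserved for `c` and `n`. -/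
def approx (R : Cantor) (c : ι) (n : ℕ) : ℚ :=
  (((Finset.range (2 ^ n)).filter fun i => R (Encodable.encode (c, n, i)) = true).card : ℚ) / 2 ^ n

variable [MeasurableSpace E]

/-- The real `R` is a representation of `μ`: it codes a fast converging sequence of rational
approximations to the measures of all basic clopen sets. -/
def IsRepresentation (B : ι → Set E) (R : Cantor) (μ : Measure E) : Prop :=
  ∀ (c : ι) (n : ℕ), |(approx R c n : ℝ) - μ.real (B c)| ≤ (2 ^ n : ℝ)⁻¹

/-- `V` is an `(R, A)`-test with respect to `μ`. -/
def IsTest (B : ι → Set E) (μ : Measure E) (R A : Cantor) (V : ℕ → Set E) : Prop :=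
  UniformlySigma01 B (join R A) V ∧ ∀ n, μ (V n) ≤ (2 ^ n : ℝ≥0∞)⁻¹

/-- The point `x` is `(R, A)`-random with respect to `μ`: it passes every `(R, A)`-test. -/
def IsRandomFor (B : ι → Set E) (μ : Measure E) (R A : Cantor) (x : E) : Prop :=
  ∀ V : ℕ → Set E, IsTest B μ R A V → x ∉ ⋂ n, V n

/-- The set of points that are `μ`-random relative to `A`, that is, `(R, A)`-random for some
representation `R` of `μ`. -/
def randomPoints (B : ι → Set E) (μ : Measure E) (A : Cantor) : Set E :=
  {x | ∃ R : Cantor, IsRepresentation B R μ ∧ IsRandomFor B μ R A x}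

/-- Every probability measure has a representation. -/
theorem exists_isRepresentation (B : ι → Set E) (μ : Measure E) [IsProbabilityMeasure μ] :
    ∃ R : Cantor, IsRepresentation B R μ := by
  let k : ι → ℕ → ℕ := fun c n => ⌊μ.real (B c) * 2 ^ n⌋₊
  let R : Cantor := fun m => match Encodable.decode (α := ι × ℕ × ℕ) m with
    | some (c, n, i) => decide (i < k c n)
    | none => false
  refine ⟨R, fun c n => ?_⟩
  have h1 : μ.real (B c) ≤ 1 := measureReal_le_one
  have h0 : 0 ≤ μ.real (B c) := measureReal_nonneg
  have hp : (0 : ℝ) < 2 ^ n := by positivity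
  have hk : k c n ≤ 2 ^ n := by
    have h : ((k c n : ℕ) : ℝ) ≤ μ.real (B c) * 2 ^ n := Nat.floor_le (by positivity)
    have h' : ((k c n : ℕ) : ℝ) ≤ ((2 ^ n : ℕ) : ℝ) := by
      push_cast; nlinarith
    exact_mod_cast h'
  have hf : ((Finset.range (2 ^ n)).filter fun i => R (Encodable.encode (c, n, i)) = true)
      = Finset.range (k c n) := by
    ext i
    simp only [R, Encodable.encodek, Finset.mem_filter, Finset.mem_range, decide_eq_true_eq]
    omega
  have ha : (approx R c n : ℝ) = (k c n : ℝ) / 2 ^ n := by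
    simp only [approx, hf, Finset.card_range]; push_cast; ring
  have h2 : ((k c n : ℕ) : ℝ) ≤ μ.real (B c) * 2 ^ n := Nat.floor_le (by positivity)
  have h3 : μ.real (B c) * 2 ^ n < (k c n : ℝ) + 1 := Nat.lt_floor_add_one _
  have h4 : (k c n : ℝ) / 2 ^ n - μ.real (B c) = ((k c n : ℝ) - μ.real (B c) * 2 ^ n) / 2 ^ n := by
    field_simp
  rw [ha, h4, abs_div, abs_of_pos hp, div_eq_mul_inv]
  have h5 : |(k c n : ℝ) - μ.real (B c) * 2 ^ n| ≤ 1 := by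
    rw [abs_le]; constructor <;> linarith
  exact mul_le_of_le_one_left (by positivity) h5

end

/-- `MLR_μ(A)` for a measure `μ` on `2^ω`. -/
def MLR (μ : Measure Cantor) (A : Cantor) : Set Cantor := randomPoints cyl μ A

/-- `MLR_ν(A)` for a measure `ν` on `2^ω × 2^ω`. -/
def MLR₂ (ν : Measure (Cantor × Cantor)) (A : Cantor) : Set (Cantor × Cantor) :=
  randomPoints cyl₂ ν A

end MLRandom

/-!
Relations between natural numbers (or other codes) and reals that are `Σ⁰₁` are handled through the
predicate `EffOpen`: the relation holds when one of its stages accepts, and a stage is a primitive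
recursive function of a finite part of the real whose length is computed in advance. The class is
closed under the operations below, and the uniformly `Σ⁰₁(Z)` sequences of classes are exactly the
sections at `Z` of its members (`IsPresentation.exists_universal`,
`IsPresentation.uniformlySigma01`).

From a random pair to its components. A representation `R` of `μ × μ` computes a representation `S`
of `μ`. A test that captures `A` yields its product with the whole space. A test `V` relative to
`S ⊕ A` that captures `B` is the section at `A` of an effectively open set of pairs; its sections at
other points may be large, so it is trimmed (`EffOpen.exists_trim`): a stage is kept only if the
approximations that `S` provides show that its measure is small. By Fubini the trimmed sets are a
test for `μ × μ`.

From the components to the pair, `A` and `B` are random with respect to possibly different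
representations of `μ`, and a representation of `μ × μ` that works for the pair has to be found.
Suppose there is none. Trimming all recursively enumerable sets gives a universal test that is
uniform in the representation `R` of `μ × μ` (`exists_universal_test`), and `(A, B)` fails it for
every `R`, so `(A, B)` belongs to the intersection `Q` of these tests over all `R`. Relative to any
representation of `μ` the representations of `μ × μ` form a `Π⁰₁` class in a compact space, hence `Q`
is still effectively open (`EffOpen.forall_real`), and it does not depend on the representation of
`μ` from which it is computed (`exists_uniform_test`). Now the classical argument applies: with
respect to the representation for `A`, the points with a large section of `Q n` form a test, so the
sections of `Q n` at `A` are small from some `n` on. This fact no longer mentions a representation,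
so with respect to the representation for `B` these sections are a test relative to `A`, which
captures `B`.
-/

namespace MLRandom

/-! ### Primitive recursive functions of a real -/

/-- The real that extends the string `σ` by zeros. -/
def pad (σ : List Bool) : Cantor := fun i => σ.getD i false

section
variable {α β γ δ : Type} [Primcodable α] [Primcodable β] [Primcodable γ] [Primcodable δ]

/-- `f a Z` is primitive recursive in `a` and the real `Z`, and reads `Z` only below a bound
that is primitive recursive in `a` alone. -/
structure OraclePrimrec (f : α → Cantor → β) : Prop where
  primrec : Primrec fun p : α × List Bool => f p.1 (pad p.2)
  use : ∃ u : α → ℕ, Primrec u ∧ ∀ a Z Z', (∀ i < u a, Z i = Z' i) → f a Z = f a Z'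

theorem primrec_sum_range {n : α → ℕ} {f : α → ℕ → ℕ} (hn : Primrec n) (hf : Primrec₂ f) :
    Primrec fun a => ∑ i ∈ Finset.range (n a), f a i := by
  have h : Primrec₂ fun (a : α) (p : ℕ × ℕ) => p.2 + f a p.1 :=
    (Primrec.nat_add.comp (Primrec.snd.comp Primrec.snd)
      (hf.comp Primrec.fst (Primrec.fst.comp Primrec.snd))).to₂
  refine (Primrec.nat_rec' hn (Primrec.const 0) h).of_eq fun a => ?_
  induction n a with
  | zero => rfl
  | succ k ih => rw [Finset.sum_range_succ, ← ih]

theorem primrec_two_pow : Primrec fun n : ℕ => 2 ^ n :=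
  (Primrec₂.unpaired'.1 Nat.Primrec.pow).comp (Primrec.const 2) Primrec.id

theorem primrec_testBit : Primrec₂ Nat.testBit := by
  have h : PrimrecRel fun N i : ℕ => N / 2 ^ i % 2 = 1 :=
    Primrec.eq.comp (Primrec.nat_mod.comp (Primrec.nat_div.comp Primrec.fst
      (primrec_two_pow.comp Primrec.snd)) (Primrec.const 2)) (Primrec.const 1)
  exact h.decide.of_eq fun N i => (Nat.testBit_eq_decide_div_mod_eq).symm

theorem primrec_pad : Primrec₂ pad := Primrec.list_getD false

theorem pad_map_range (Z : Cantor) {i n : ℕ} (h : i < n) : pad ((List.range n).map Z) i = Z i := by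
  simp [pad, List.getD, h]

namespace OraclePrimrec

theorem of_primrec {f : α → β} (hf : Primrec f) : OraclePrimrec fun a _ => f a :=
  ⟨hf.comp Primrec.fst, fun _ => 0, Primrec.const 0, fun _ _ _ _ => rfl⟩

theorem bit {g : α → ℕ} (hg : Primrec g) : OraclePrimrec fun a Z => Z (g a) :=
  ⟨primrec_pad.comp Primrec.snd (hg.comp Primrec.fst), fun a => g a + 1, Primrec.succ.comp hg,
    fun _ _ _ h => h _ (Nat.lt_succ_self _)⟩

theorem map {g : β → γ} (hg : Primrec g) {f : α → Cantor → β} (hf : OraclePrimrec f) :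
    OraclePrimrec fun a Z => g (f a Z) := by
  obtain ⟨h, u, hu, h'⟩ := hf
  exact ⟨hg.comp h, u, hu, fun a Z Z' e => congrArg g (h' a Z Z' e)⟩

theorem map₂ {g : β → γ → δ} (hg : Primrec₂ g) {f : α → Cantor → β} {f' : α → Cantor → γ}
    (hf : OraclePrimrec f) (hf' : OraclePrimrec f') :
    OraclePrimrec fun a Z => g (f a Z) (f' a Z) := by
  obtain ⟨h, u, hu, h1⟩ := hf
  obtain ⟨h', u', hu', h1'⟩ := hf'
  refine ⟨hg.comp h h', fun a => max (u a) (u' a), Primrec.nat_max.comp hu hu', fun a Z Z' e => ?_⟩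
  rw [h1 a Z Z' fun i hi => e i (lt_max_of_lt_left hi),
    h1' a Z Z' fun i hi => e i (lt_max_of_lt_right hi)]

theorem comp {f : α → Cantor → β} (hf : OraclePrimrec f) {g : γ → α} (hg : Primrec g) :
    OraclePrimrec fun c Z => f (g c) Z := by
  obtain ⟨h, u, hu, h'⟩ := hf
  exact ⟨h.comp ((hg.comp Primrec.fst).pair Primrec.snd), fun c => u (g c), hu.comp hg,
    fun c Z Z' e => h' (g c) Z Z' e⟩

theorem sum_range {n : α → ℕ} (hn : Primrec n) {f : α × ℕ → Cantor → ℕ} (hf : OraclePrimrec f) :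
    OraclePrimrec fun a Z => ∑ i ∈ Finset.range (n a), f (a, i) Z := by
  obtain ⟨h, u, hu, h'⟩ := hf
  refine ⟨?_, fun a => ∑ i ∈ Finset.range (n a), u (a, i), primrec_sum_range hn hu.to₂,
    fun a Z Z' e => Finset.sum_congr rfl fun i hi => h' _ _ _ fun j hj => e j ?_⟩
  · exact primrec_sum_range (hn.comp Primrec.fst) (f := fun (p : α × List Bool) i =>
      f (p.1, i) (pad p.2)) (h.comp (((Primrec.fst.comp Primrec.fst).pair Primrec.snd).pair
        (Primrec.snd.comp Primrec.fst)))
  · exact hj.trans_le (Finset.single_le_sum (f := fun i => u (a, i)) (fun _ _ => Nat.zero_le _) hi)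

theorem and {f g : α → Cantor → Bool} (hf : OraclePrimrec f) (hg : OraclePrimrec g) :
    OraclePrimrec fun a Z => f a Z && g a Z := map₂ Primrec.and hf hg

theorem lt {f g : α → Cantor → ℕ} (hf : OraclePrimrec f) (hg : OraclePrimrec g) :
    OraclePrimrec fun a Z => decide (f a Z < g a Z) := map₂ Primrec.nat_lt.decide hf hg

theorem add {f g : α → Cantor → ℕ} (hf : OraclePrimrec f) (hg : OraclePrimrec g) :
    OraclePrimrec fun a Z => f a Z + g a Z := map₂ Primrec.nat_add hf hg

theorem mul {f g : α → Cantor → ℕ} (hf : OraclePrimrec f) (hg : OraclePrimrec g) :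
    OraclePrimrec fun a Z => f a Z * g a Z := map₂ Primrec.nat_mul hf hg

theorem toNat {f : α → Cantor → Bool} (hf : OraclePrimrec f) :
    OraclePrimrec fun a Z => (f a Z).toNat := map (Primrec.dom_bool _) hf

/-- The value at `none` is `false`; this lets a search run over codes that may fail to decode. -/
theorem optionElim {f : α → Cantor → Bool} (hf : OraclePrimrec f) :
    OraclePrimrec fun (o : Option α) Z => o.elim false fun a => f a Z := by
  obtain ⟨h, u, hu, h'⟩ := hf
  refine ⟨?_, fun o => o.elim 0 u, ?_, ?_⟩
  · refine (Primrec.option_casesOn (Primrec.fst (α := Option α) (β := List Bool))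
      (Primrec.const false) (h.comp (Primrec.snd.pair (Primrec.snd.comp Primrec.fst))).to₂).of_eq
      fun p => ?_
    rcases p with ⟨_ | a, σ⟩ <;> rfl
  · refine (Primrec.option_casesOn Primrec.id (Primrec.const 0)
      (hu.comp Primrec.snd).to₂).of_eq fun o => ?_
    cases o <;> rfl
  · rintro (_ | a) Z Z' e
    · rfl
    · exact h' a Z Z' e

theorem exists_lt {n : α → ℕ} (hn : Primrec n) {f : α × ℕ → Cantor → Bool}
    (hf : OraclePrimrec f) :
    ∃ g : α → Cantor → Bool, OraclePrimrec g ∧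
      ∀ a Z, g a Z = true ↔ ∃ i < n a, f (a, i) Z = true := by
  refine ⟨_, lt (of_primrec (Primrec.const 0)) (sum_range hn hf.toNat), fun a Z => ?_⟩
  have h (b : Bool) : 0 < b.toNat ↔ b = true := by cases b <;> simp
  simp [Finset.sum_pos_iff, h]

theorem forall_lt {n : α → ℕ} (hn : Primrec n) {f : α × ℕ → Cantor → Bool}
    (hf : OraclePrimrec f) :
    ∃ g : α → Cantor → Bool, OraclePrimrec g ∧
      ∀ a Z, g a Z = true ↔ ∀ i < n a, f (a, i) Z = true := by
  obtain ⟨g, hg, h⟩ := exists_lt hn (hf.map Primrec.not)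
  refine ⟨_, hg.map Primrec.not, fun a Z => ?_⟩
  have := h a Z
  cases hh : g a Z <;> simp_all

end OraclePrimrec

/-- The real `Φ a Z` is computed bit by bit from `a` and `Z`. -/
def OracleMap (Φ : α → Cantor → Cantor) : Prop :=
  OraclePrimrec fun (p : α × ℕ) Z => Φ p.1 Z p.2

/-- The bound on the use of `f` determines which bits of `Φ a Z` are needed, and the bounds on their
uses are added up. -/
theorem OraclePrimrec.subst {f : α → Cantor → β} (hf : OraclePrimrec f)
    {Φ : α → Cantor → Cantor} (hΦ : OracleMap Φ) : OraclePrimrec fun a Z => f a (Φ a Z) := by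
  obtain ⟨h, u, hu, h'⟩ := hf
  obtain ⟨k, v, hv, k'⟩ := hΦ
  constructor
  · have h1 : Primrec fun p : α × List Bool => (List.range (u p.1)).map (Φ p.1 (pad p.2)) :=
      Primrec.list_map (Primrec.list_range.comp (hu.comp Primrec.fst))
        (g := fun (p : α × List Bool) (i : ℕ) => Φ p.1 (pad p.2) i)
        (k.comp (((Primrec.fst.comp Primrec.fst).pair Primrec.snd).pair
          (Primrec.snd.comp Primrec.fst))).to₂
    exact (h.comp (Primrec.fst.pair h1)).of_eq fun p =>
      h' _ _ _ fun i hi => pad_map_range _ hi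
  · refine ⟨fun a => ∑ i ∈ Finset.range (u a), v (a, i), primrec_sum_range hu hv.to₂,
      fun a Z Z' e => h' _ _ _ fun i hi => k' (a, i) Z Z' fun j hj => e j ?_⟩
    exact hj.trans_le (Finset.single_le_sum (f := fun i => v (a, i)) (fun _ _ => Nat.zero_le _)
      (Finset.mem_range.2 hi))

/-- The even half of a real, the left inverse of `join` in the first argument. -/
def evens (Z : Cantor) : Cantor := fun i => Z (2 * i)

/-- The odd half of a real, the left inverse of `join` in the second argument. -/
def odds (Z : Cantor) : Cantor := fun i => Z (2 * i + 1)

@[simp] theorem evens_join (X Y : Cantor) : evens (join X Y) = X := by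
  funext i; simp [evens, join]

@[simp] theorem odds_join (X Y : Cantor) : odds (join X Y) = Y := by
  funext i
  have : (2 * i + 1) / 2 = i := by omega
  simp [odds, join, this, Nat.add_mod]

namespace OracleMap

theorem id : OracleMap fun (_ : α) Z => Z := OraclePrimrec.bit Primrec.snd

theorem const {q : α → Cantor} (hq : Primrec₂ q) : OracleMap fun a _ => q a :=
  OraclePrimrec.of_primrec hq

theorem reindex {Φ : α → Cantor → Cantor} (hΦ : OracleMap Φ) {g : ℕ → ℕ} (hg : Primrec g) :
    OracleMap fun a Z i => Φ a Z (g i) :=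
  OraclePrimrec.comp hΦ (Primrec.fst.pair (hg.comp Primrec.snd))

theorem comp {Φ : α → Cantor → Cantor} (hΦ : OracleMap Φ) {g : γ → α} (hg : Primrec g) :
    OracleMap fun c Z => Φ (g c) Z :=
  OraclePrimrec.comp hΦ ((hg.comp Primrec.fst).pair Primrec.snd)

theorem evens {Φ : α → Cantor → Cantor} (hΦ : OracleMap Φ) : OracleMap fun a Z => evens (Φ a Z) :=
  hΦ.reindex Primrec.nat_double

theorem odds {Φ : α → Cantor → Cantor} (hΦ : OracleMap Φ) : OracleMap fun a Z => odds (Φ a Z) :=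
  hΦ.reindex Primrec.nat_double_succ

theorem join {Φ Ψ : α → Cantor → Cantor} (hΦ : OracleMap Φ) (hΨ : OracleMap Ψ) :
    OracleMap fun a Z => join (Φ a Z) (Ψ a Z) := by
  have hd : Primrec fun i : ℕ => i / 2 := Primrec.nat_div.comp Primrec.id (Primrec.const 2)
  have hm : Primrec fun p : α × ℕ => decide (p.2 % 2 = 0) :=
    (Primrec.eq.comp (Primrec.nat_mod.comp Primrec.snd (Primrec.const 2)) (Primrec.const 0)).decide
  have hc : Primrec₂ fun (c : Bool) (p : Bool × Bool) => bif c then p.1 else p.2 :=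
    Primrec.cond Primrec.fst (Primrec.fst.comp Primrec.snd) (Primrec.snd.comp Primrec.snd)
  have := OraclePrimrec.map₂ hc (OraclePrimrec.of_primrec hm)
    (OraclePrimrec.map₂ Primrec₂.pair (hΦ.reindex hd) (hΨ.reindex hd))
  unfold OracleMap
  convert this using 3
  simp [MLRandom.join, Bool.cond_eq_ite]

end OracleMap

/-- The binary expansion of a natural number, as a real. -/
def bits (N : ℕ) : Cantor := fun i => N.testBit i

theorem exists_bits_eq (X : Cantor) (L : ℕ) : ∃ N < 2 ^ L, ∀ i < L, bits N i = X i :=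
  ⟨Nat.ofBits fun i : Fin L => X i, Nat.ofBits_lt_two_pow _, fun i hi =>
    Nat.testBit_ofBits_lt _ i hi⟩

theorem bits_inj {L N M : ℕ} (hN : N < 2 ^ L) (hM : M < 2 ^ L)
    (h : ∀ i < L, bits N i = bits M i) : N = M := by
  refine Nat.eq_of_testBit_eq fun i => ?_
  rcases lt_or_ge i L with hi | hi
  · exact h i hi
  · have := Nat.pow_le_pow_right (n := 2) two_pos hi
    rw [Nat.testBit_lt_two_pow (hN.trans_le this), Nat.testBit_lt_two_pow (hM.trans_le this)]

theorem join_congr_right (Z : Cantor) {Y Y' : Cantor} {n : ℕ} (h : ∀ i < n, Y i = Y' i) :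
    ∀ i < n, join Z Y i = join Z Y' i := fun i hi => by
  simp only [join]
  split_ifs
  · rfl
  · exact h _ (lt_of_le_of_lt (Nat.div_le_self _ _) hi)

theorem isOpen_of_use {b : Cantor → Bool} (L : ℕ)
    (h : ∀ Y Y', (∀ i < L, Y i = Y' i) → b Y = b Y') : IsOpen {Y | b Y = true} := by
  refine isOpen_iff_forall_mem_open.2 fun X hX =>
    ⟨(Set.Iio L).pi fun i => {X i}, fun Y hY => ?_,
      isOpen_set_pi (Set.finite_Iio L) fun _ _ => isOpen_discrete _, fun _ _ => rfl⟩
  rw [Set.mem_ofPred_eq, h Y X fun i hi => hY i hi]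
  exact hX

/-! ### Effectively open relations -/

/-- `P` is a `Σ⁰₁` relation between elements of `α` and reals. -/
def EffOpen (P : α → Cantor → Prop) : Prop :=
  ∃ f : α × ℕ → Cantor → Bool, OraclePrimrec f ∧ ∀ a Z, P a Z ↔ ∃ s, f (a, s) Z = true

namespace EffOpen

theorem of_bool {f : α → Cantor → Bool} (hf : OraclePrimrec f) :
    EffOpen fun a Z => f a Z = true :=
  ⟨fun p Z => f p.1 Z, hf.comp Primrec.fst, fun a Z => by simp⟩

theorem exists' {P : α × β → Cantor → Prop} (hP : EffOpen P) :
    EffOpen fun a Z => ∃ b, P (a, b) Z := by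
  obtain ⟨f, hf, h⟩ := hP
  let g : α × ℕ → Option ((α × β) × ℕ) := fun p =>
    (Encodable.decode (α := β × ℕ) p.2).map fun q => ((p.1, q.1), q.2)
  have hg : Primrec g := Primrec.option_map (Primrec.decode.comp Primrec.snd)
    (((Primrec.fst.comp Primrec.fst).pair (Primrec.fst.comp Primrec.snd)).pair
      (Primrec.snd.comp Primrec.snd)).to₂
  refine ⟨_, hf.optionElim.comp hg, fun a Z => ?_⟩
  constructor
  · rintro ⟨b, hb⟩
    obtain ⟨s, hs⟩ := (h _ _).1 hb
    exact ⟨Encodable.encode (b, s), by simpa [g] using hs⟩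
  · rintro ⟨t, ht⟩
    rcases hd : Encodable.decode (α := β × ℕ) t with _ | ⟨b, s⟩
    · simp only [g, hd, Option.map_none, Option.elim_none, Bool.false_eq_true] at ht
    · simp only [g, hd, Option.map_some, Option.elim_some] at ht
      exact ⟨b, (h _ _).2 ⟨s, ht⟩⟩

theorem or {P Q : α → Cantor → Prop} (hP : EffOpen P) (hQ : EffOpen Q) :
    EffOpen fun a Z => P a Z ∨ Q a Z := by
  obtain ⟨f, hf, h⟩ := hP
  obtain ⟨g, hg, h'⟩ := hQ
  refine ⟨_, OraclePrimrec.map₂ Primrec.or hf hg, fun a Z => ?_⟩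
  simp only [h, h', Bool.or_eq_true, exists_or]

theorem comp {P : α → Cantor → Prop} (hP : EffOpen P) {g : γ → α} (hg : Primrec g) :
    EffOpen fun c Z => P (g c) Z := by
  obtain ⟨f, hf, h⟩ := hP
  exact ⟨_, hf.comp ((hg.comp Primrec.fst).pair Primrec.snd), fun c Z => h _ _⟩

/-- Effective openness is preserved when the real is replaced by one computed from it. -/
theorem subst {P : α → Cantor → Prop} (hP : EffOpen P) {Φ : α → Cantor → Cantor}
    (hΦ : OracleMap Φ) : EffOpen fun a Z => P a (Φ a Z) := by
  obtain ⟨f, hf, h⟩ := hP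
  exact ⟨_, hf.subst (hΦ.comp Primrec.fst), fun c Z => h _ _⟩

/-- An effectively open relation is an increasing union of decidable stages, and stage `s` reads
only the first `u (a, s)` bits of the real. -/
theorem exists_stages {P : α → Cantor → Prop} (hP : EffOpen P) :
    ∃ (f : α × ℕ → Cantor → Bool) (u : α × ℕ → ℕ), OraclePrimrec f ∧ Primrec u ∧
      (∀ p Z Z', (∀ i < u p, Z i = Z' i) → f p Z = f p Z') ∧
      (∀ a s t Z, s ≤ t → f (a, s) Z = true → f (a, t) Z = true) ∧
      ∀ a Z, P a Z ↔ ∃ s, f (a, s) Z = true := by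
  obtain ⟨f, hf, h⟩ := hP
  obtain ⟨g, hg, h'⟩ := OraclePrimrec.exists_lt (α := α × ℕ) Primrec.snd
    (hf.comp ((Primrec.fst.comp Primrec.fst).pair Primrec.snd))
  obtain ⟨-, u, hu, hgu⟩ := id hg
  refine ⟨g, u, hg, hu, hgu, fun a s t Z hst => ?_, fun a Z => ?_⟩
  · rw [h', h']
    rintro ⟨i, hi, e⟩
    exact ⟨i, lt_of_lt_of_le hi hst, e⟩
  · rw [h]
    constructor
    · rintro ⟨s, e⟩
      exact ⟨s + 1, (h' _ _).2 ⟨s, Nat.lt_succ_self s, e⟩⟩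
    · rintro ⟨s, e⟩
      obtain ⟨i, -, e⟩ := (h' _ _).1 e
      exact ⟨i, e⟩

/-- Universal quantification over a real preserves effective openness: since Cantor space is
compact, one stage has to accept every real, and it can be tested on finitely many strings. -/
theorem forall_real {P : α → Cantor → Prop} (hP : EffOpen P) :
    EffOpen fun a Z => ∀ Y, P a (join Z Y) := by
  obtain ⟨f, u, hf, hu, hfu, hmono, h⟩ := hP.exists_stages
  obtain ⟨g, hg, hg'⟩ := OraclePrimrec.forall_lt (α := α × ℕ) (primrec_two_pow.comp hu)
    ((hf.comp Primrec.fst).subst (OracleMap.join OracleMap.id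
      (OracleMap.const (q := fun p : (α × ℕ) × ℕ => bits p.2)
        (primrec_testBit.comp (Primrec.snd.comp Primrec.fst) Primrec.snd).to₂)))
  have hall : ∀ p Z, g p Z = true ↔ ∀ Y, f p (join Z Y) = true := fun p Z => by
    rw [hg']
    constructor
    · intro H Y
      obtain ⟨N, hN, e⟩ := exists_bits_eq Y (u p)
      rw [← H N hN]
      exact hfu _ _ _ (join_congr_right Z fun i hi => (e i hi).symm)
    · exact fun H N _ => H _
  refine ⟨g, hg, fun a Z => ?_⟩
  simp only [hall, h]
  constructor
  · intro H
    obtain ⟨s, hs⟩ := isCompact_univ.elim_directed_cover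
      (fun s => {Y | f (a, s) (join Z Y) = true})
      (fun s => isOpen_of_use (u (a, s)) (fun Y Y' e => hfu _ _ _ (join_congr_right Z e)))
      (fun Y _ => Set.mem_iUnion.2 (H Y))
      (Monotone.directed_le fun s t hst Y => hmono a s t _ hst)
    exact ⟨s, fun Y => hs (Set.mem_univ Y)⟩
  · exact fun ⟨s, hs⟩ Y => ⟨s, hs Y⟩

end EffOpen

end

/-! ### Uniformly `Σ⁰₁` classes as effectively open relations -/

section
variable {α E ι : Type} [Primcodable α] [Primcodable ι]

/-- The family `B` of basic sets is effectively presented through the coding `D` of points by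
reals: membership in `B c` is decidable from the code of the point, and `B c` constrains
the first `len c` bits of the code to those of a computable real `q c`, with `len c`
arbitrarily large near each point. -/
structure IsPresentation (B : ι → Set E) (D : E → Cantor) : Prop where
  mem : ∃ m : ι → Cantor → Bool, OraclePrimrec m ∧ ∀ c x, m c (D x) = true ↔ x ∈ B c
  approx : ∃ (q : ι → Cantor) (len : ι → ℕ), Primrec₂ q ∧ Primrec len ∧
    (∀ c, ∀ x ∈ B c, ∀ i < len c, D x i = q c i) ∧ ∀ x L, ∃ c, x ∈ B c ∧ L ≤ len c

theorem isInitSeg_iff_pad {σ : List Bool} {X : Cantor} :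
    IsInitSeg σ X ↔ ∀ i < σ.length, X i = pad σ i := by
  refine forall₂_congr fun i h => ?_
  simp [pad, List.getD, h]

/-- The initial segment of length `L` of the real `X`. -/
def prefixOf (X : Cantor) (L : ℕ) : List Bool := (List.range L).map X

@[simp] theorem length_prefixOf (X : Cantor) (L : ℕ) : (prefixOf X L).length = L := by
  simp [prefixOf]

theorem isInitSeg_prefixOf {X Y : Cantor} {L : ℕ} :
    IsInitSeg (prefixOf X L) Y ↔ ∀ i < L, Y i = X i := by
  simp +contextual [IsInitSeg, prefixOf]

theorem OraclePrimrec.exists_isInitSeg : ∃ m : List Bool → Cantor → Bool,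
    OraclePrimrec m ∧ ∀ σ X, m σ X = true ↔ IsInitSeg σ X := by
  have h : OraclePrimrec fun (p : List Bool × ℕ) X => (X p.2 == pad p.1 p.2) :=
    OraclePrimrec.map₂ Primrec.beq (OraclePrimrec.bit Primrec.snd)
      (OraclePrimrec.of_primrec primrec_pad)
  obtain ⟨m, hm, h'⟩ := OraclePrimrec.forall_lt Primrec.list_length h
  exact ⟨m, hm, fun σ X => by simp [h', isInitSeg_iff_pad]⟩

theorem isPresentation_cyl : IsPresentation cyl (fun X : Cantor => X) where
  mem := OraclePrimrec.exists_isInitSeg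
  approx := ⟨pad, List.length, primrec_pad, Primrec.list_length,
    fun σ X h => isInitSeg_iff_pad.1 h,
    fun X L => ⟨prefixOf X L, isInitSeg_prefixOf.2 fun _ _ => rfl, by simp⟩⟩

theorem isPresentation_cyl₂ : IsPresentation cyl₂ fun p => join p.1 p.2 where
  mem := by
    obtain ⟨m, hm, h⟩ := OraclePrimrec.exists_isInitSeg
    refine ⟨_, ((hm.comp Primrec.fst).subst (OracleMap.id.evens)).and
      ((hm.comp Primrec.snd).subst (OracleMap.id.odds)), fun c x => ?_⟩
    simp [h, cyl₂, cyl]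
  approx := by
    refine ⟨fun c => join (pad c.1) (pad c.2), fun c => min c.1.length c.2.length, ?_,
      Primrec.nat_min.comp (Primrec.list_length.comp Primrec.fst)
        (Primrec.list_length.comp Primrec.snd), ?_, ?_⟩
    · have h1 : Primrec₂ fun (c : List Bool × List Bool) i => pad c.1 i :=
        (primrec_pad.comp (Primrec.fst.comp Primrec.fst) Primrec.snd).to₂
      have h2 : Primrec₂ fun (c : List Bool × List Bool) i => pad c.2 i :=
        (primrec_pad.comp (Primrec.snd.comp Primrec.fst) Primrec.snd).to₂
      have h : OracleMap fun (c : List Bool × List Bool) _ => join (pad c.1) (pad c.2) :=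
        (OracleMap.const h1).join (OracleMap.const h2)
      exact h.primrec.comp (Primrec.id.pair (Primrec.const []))
    · rintro c x ⟨h1, h2⟩ i hi
      have hi' : i / 2 < min c.1.length c.2.length := lt_of_le_of_lt (Nat.div_le_self _ _) hi
      simp only [join, isInitSeg_iff_pad.1 h1 _ (lt_min_iff.1 hi').1,
        isInitSeg_iff_pad.1 h2 _ (lt_min_iff.1 hi').2]
    · exact fun x L => ⟨(prefixOf x.1 L, prefixOf x.2 L),
        ⟨isInitSeg_prefixOf.2 fun _ _ => rfl, isInitSeg_prefixOf.2 fun _ _ => rfl⟩, by simp⟩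

/-- There is a universal recursively enumerable predicate with decidable stages. -/
theorem exists_universal_rePred (β : Type) [Primcodable β] :
    ∃ w : ℕ × β × ℕ → Bool, Primrec w ∧
      ∀ W : β → Prop, REPred W → ∃ e, ∀ b, W b ↔ ∃ s, w (e, b, s) = true := by
  refine ⟨fun p => (Nat.Partrec.Code.evaln p.2.2 (Denumerable.ofNat Nat.Partrec.Code p.1)
    (Encodable.encode p.2.1)).isSome, ?_, fun W hW => ?_⟩
  · exact Primrec.option_isSome.comp (Nat.Partrec.Code.primrec_evaln.comp
      (((Primrec.snd.comp Primrec.snd).pair ((Primrec.ofNat _).comp Primrec.fst)).pair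
        (Primrec.encode.comp (Primrec.fst.comp Primrec.snd))))
  · obtain ⟨c, hc⟩ := Nat.Partrec.Code.exists_code.1 hW
    refine ⟨Encodable.encode c, fun b => ?_⟩
    have h1 : W b ↔ (c.eval (Encodable.encode b)).Dom := by
      rw [hc]; simp [Part.assert]
    rw [h1, Part.dom_iff_mem]
    simp only [Nat.Partrec.Code.evaln_complete, Denumerable.ofNat_encode, Option.isSome_iff_exists,
      Option.mem_def]
    exact exists_comm

theorem rePred_exists_stage {β : Type} [Primcodable β] {f : β × ℕ → Bool} (hf : Primrec f) :
    REPred fun b => ∃ s, f (b, s) = true := by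
  have h : Computable₂ fun (b : β) (s : ℕ) => if f (b, s) then some () else none :=
    (Primrec.ite (Primrec.eq.comp hf (Primrec.const true)) (Primrec.const (some ()))
      (Primrec.const none)).to_comp.to₂
  refine (Partrec.rfindOpt h).dom_re.of_eq fun b => ?_
  simp [Nat.rfindOpt_dom]

/-- The uniformly `Σ⁰₁` sequences of classes have a universal enumeration. -/
theorem IsPresentation.exists_universal {B : ι → Set E} {D : E → Cantor}
    (hB : IsPresentation B D) :
    ∃ P : ℕ × ℕ → Cantor → Prop, EffOpen P ∧ ∀ Z V, UniformlySigma01 B Z V →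
      ∃ e, ∀ n x, x ∈ V n ↔ P (e, n) (join Z (D x)) := by
  obtain ⟨w, hw, hw'⟩ := exists_universal_rePred (ℕ × ι × List Bool)
  obtain ⟨m, hm, hm'⟩ := hB.mem
  obtain ⟨i, hi, hi'⟩ := OraclePrimrec.exists_isInitSeg
  let K : (ℕ × ℕ) × ((ι × List Bool) × ℕ) → Cantor → Bool := fun p Z =>
    w (p.1.1, (p.1.2, p.2.1.1, p.2.1.2), p.2.2) && (i p.2.1.2 (evens Z) && m p.2.1.1 (odds Z))
  have hcτ : Primrec fun p : (ℕ × ℕ) × ((ι × List Bool) × ℕ) => p.2.1 :=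
    Primrec.fst.comp Primrec.snd
  have hK : OraclePrimrec K :=
    (OraclePrimrec.of_primrec (hw.comp ((Primrec.fst.comp Primrec.fst).pair
      (((Primrec.snd.comp Primrec.fst).pair ((Primrec.fst.comp hcτ).pair
        (Primrec.snd.comp hcτ))).pair (Primrec.snd.comp Primrec.snd))))).and
      (((hi.comp (Primrec.snd.comp hcτ)).subst OracleMap.id.evens).and
        ((hm.comp (Primrec.fst.comp hcτ)).subst OracleMap.id.odds))
  refine ⟨_, (EffOpen.of_bool hK).exists', fun Z V ⟨W, hW, hV⟩ => ?_⟩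
  obtain ⟨e, he⟩ := hw' W hW
  refine ⟨e, fun n x => ?_⟩
  rw [hV]
  constructor
  · rintro ⟨c, τ, h1, h2, h3⟩
    obtain ⟨s, hs⟩ := (he _).1 h1
    exact ⟨((c, τ), s), by simp [K, hs, (hi' _ _).2 h2, (hm' _ _).2 h3]⟩
  · rintro ⟨⟨⟨c, τ⟩, s⟩, h⟩
    simp only [K, evens_join, odds_join, Bool.and_eq_true] at h
    exact ⟨c, τ, (he _).2 ⟨s, h.1⟩, (hi' _ _).1 h.2.1, (hm' _ _).1 h.2.2⟩

/-- The sections of an effectively open relation at a real `Z` are uniformly `Σ⁰₁(Z)`. -/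
theorem IsPresentation.uniformlySigma01 {B : ι → Set E} {D : E → Cantor}
    (hB : IsPresentation B D) {P : ℕ → Cantor → Prop} (hP : EffOpen P) (Z : Cantor) :
    UniformlySigma01 B Z fun n => {x | P n (join Z (D x))} := by
  obtain ⟨f, hf, hP⟩ := hP
  obtain ⟨-, u, hu, hfu⟩ := id hf
  obtain ⟨q, len, hq, hlen, hBq, hBlen⟩ := hB.approx
  have hbase : ∀ n s (Z' Y Y' : Cantor), (∀ i < u (n, s), Z i = Z' i) →
      (∀ i < u (n, s), Y i = Y' i) → f (n, s) (join Z Y) = f (n, s) (join Z' Y') := by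
    refine fun n s Z' Y Y' h h' => hfu _ _ _ fun i hi => ?_
    have hi' := lt_of_le_of_lt (Nat.div_le_self i 2) hi
    simp only [join, h _ hi', h' _ hi']
  -- `(n, c, τ)` is enumerated when some stage that reads no more than `τ` and the bits fixed by
  -- `B c` accepts them.
  let g : (ℕ × ι × List Bool) × ℕ → Bool := fun p =>
    decide (u (p.1.1, p.2) ≤ p.1.2.2.length) && (decide (u (p.1.1, p.2) ≤ len p.1.2.1) &&
      f (p.1.1, p.2) (join (pad p.1.2.2) (q p.1.2.1)))
  have hg : Primrec g := by
    have hτ : Primrec fun p : (ℕ × ι × List Bool) × ℕ => p.1.2.2 :=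
      Primrec.snd.comp (Primrec.snd.comp Primrec.fst)
    have hc : Primrec fun p : (ℕ × ι × List Bool) × ℕ => p.1.2.1 :=
      Primrec.fst.comp (Primrec.snd.comp Primrec.fst)
    have hns : Primrec fun p : (ℕ × ι × List Bool) × ℕ => (p.1.1, p.2) :=
      (Primrec.fst.comp Primrec.fst).pair Primrec.snd
    have h1 : Primrec₂ fun (p : (ℕ × ι × List Bool) × ℕ) i => pad p.1.2.2 i :=
      (primrec_pad.comp (hτ.comp Primrec.fst) Primrec.snd).to₂
    have h2 : Primrec₂ fun (p : (ℕ × ι × List Bool) × ℕ) i => q p.1.2.1 i :=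
      (hq.comp (hc.comp Primrec.fst) Primrec.snd).to₂
    have hj : OracleMap fun (p : (ℕ × ι × List Bool) × ℕ) _ => join (pad p.1.2.2) (q p.1.2.1) :=
      (OracleMap.const h1).join (OracleMap.const h2)
    have h3 := ((hf.comp hns).subst hj).primrec.comp (Primrec.id.pair (Primrec.const []))
    exact Primrec.and.comp (Primrec.nat_le.decide.comp (hu.comp hns) (Primrec.list_length.comp hτ))
      (Primrec.and.comp (Primrec.nat_le.decide.comp (hu.comp hns) (hlen.comp hc)) h3)
  refine ⟨_, rePred_exists_stage hg, fun n => Set.ext fun x => ?_⟩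
  simp only [Set.mem_ofPred_eq, hP, g, Bool.and_eq_true, decide_eq_true_eq]
  constructor
  · rintro ⟨s, hs⟩
    obtain ⟨c, hxc, hc⟩ := hBlen x (u (n, s))
    refine ⟨c, prefixOf Z (u (n, s)), ⟨s, by simp, hc, ?_⟩, isInitSeg_prefixOf.2 fun _ _ => rfl,
      hxc⟩
    rw [← hs]
    exact (hbase n s _ _ _ (fun i hi => (pad_map_range Z hi).symm)
      fun i hi => hBq c x hxc i (hi.trans_le hc)).symm
  · rintro ⟨c, τ, ⟨s, h1, h2, h3⟩, hτ, hxc⟩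
    refine ⟨s, ?_⟩
    rw [← h3]
    exact hbase n s _ _ _ (fun i hi => isInitSeg_iff_pad.1 hτ i (hi.trans_le h1))
      fun i hi => hBq c x hxc i (hi.trans_le h2)

end

/-! ### Approximating the measure of effectively open sets -/

section
variable {α ι E : Type} [Primcodable α] [Primcodable ι]

/-- The number of ones in the block of `R` reserved for `c` and `n`, that is, `2 ^ n` times the
approximation `approx R c n`. -/
def count (R : Cantor) (c : ι) (n : ℕ) : ℕ :=
  ((Finset.range (2 ^ n)).filter fun i => R (Encodable.encode (c, n, i)) = true).card

theorem count_le (R : Cantor) (c : ι) (n : ℕ) : count R c n ≤ 2 ^ n :=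
  (Finset.card_filter_le _ _).trans (Finset.card_range _).le

theorem OraclePrimrec.count : OraclePrimrec fun (p : ι × ℕ) R => count R p.1 p.2 := by
  have h : OraclePrimrec fun (p : (ι × ℕ) × ℕ) R => R (Encodable.encode (p.1.1, p.1.2, p.2)) :=
    OraclePrimrec.bit (Primrec.encode.comp ((Primrec.fst.comp Primrec.fst).pair
      ((Primrec.snd.comp Primrec.fst).pair Primrec.snd)))
  have := OraclePrimrec.sum_range (primrec_two_pow.comp (Primrec.snd (α := ι) (β := ℕ))) h.toNat
  convert this using 3 with p R
  rw [MLRandom.count, Finset.card_filter]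
  exact Finset.sum_congr rfl fun i _ => by
    cases R (Encodable.encode (p.1, p.2, i)) <;> rfl

theorem IsRepresentation.abs_count_sub_le [MeasurableSpace E] {B : ι → Set E} {R : Cantor}
    {μ : Measure E} (hR : IsRepresentation B R μ) (c : ι) (n : ℕ) :
    |(count R c n : ℝ) - 2 ^ n * μ.real (B c)| ≤ 1 := by
  have h := hR c n
  have hp : (0 : ℝ) < 2 ^ n := by positivity
  have e : (count R c n : ℝ) - 2 ^ n * μ.real (B c) =
      2 ^ n * ((approx R c n : ℝ) - μ.real (B c)) := by
    simp only [approx, count]; push_cast; field_simp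
  rw [e, abs_mul, abs_of_pos hp]
  calc (2 : ℝ) ^ n * |(approx R c n : ℝ) - μ.real (B c)| ≤ 2 ^ n * (2 ^ n)⁻¹ := by gcongr
    _ = 1 := mul_inv_cancel₀ hp.ne'

theorem mem_cyl_prefixOf {X Y : Cantor} {L : ℕ} :
    Y ∈ cyl (prefixOf X L) ↔ ∀ i < L, Y i = X i := isInitSeg_prefixOf

theorem measurableSet_cyl (s : List Bool) : MeasurableSet (cyl s) := by
  have : cyl s = ⋂ i ∈ Set.Iio s.length, {Y : Cantor | Y i = pad s i} := by
    ext Y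
    simp only [cyl, Set.mem_ofPred_eq, isInitSeg_iff_pad, Set.mem_iInter, Set.mem_Iio]
  rw [this]
  exact MeasurableSet.biInter (Set.to_countable _) fun i _ =>
    (measurable_pi_apply i : Measurable fun Y : Cantor => Y i) (measurableSet_singleton (pad s i))

/-- A clopen set given by a decision on the first `L` bits is the disjoint union of the accepted
cylinders of length `L`. -/
theorem measureReal_eq_sum_cyl (μ : Measure Cantor) [IsProbabilityMeasure μ] {b : Cantor → Bool}
    {L : ℕ} (h : ∀ Y Y', (∀ i < L, Y i = Y' i) → b Y = b Y') :
    μ.real {X | b X = true} = ∑ N ∈ Finset.range (2 ^ L),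
      ((b (bits N)).toNat : ℝ) * μ.real (cyl (prefixOf (bits N) L)) := by
  have hset : {X | b X = true} =
      ⋃ N ∈ (Finset.range (2 ^ L)).filter fun N => b (bits N) = true,
        cyl (prefixOf (bits N) L) := by
    ext X
    simp only [Set.mem_ofPred_eq, Finset.mem_filter, Finset.mem_range, Set.mem_iUnion,
      mem_cyl_prefixOf, exists_prop]
    constructor
    · intro hX
      obtain ⟨N, hN, e⟩ := exists_bits_eq X L
      exact ⟨N, ⟨hN, (h _ _ e).trans hX⟩, fun i hi => (e i hi).symm⟩
    · rintro ⟨N, ⟨-, hb⟩, e⟩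
      exact (h _ _ e).trans hb
  rw [hset, measureReal_biUnion_finset _ (fun N _ => measurableSet_cyl _), Finset.sum_filter]
  · refine Finset.sum_congr rfl fun N _ => ?_
    cases b (bits N) <;> simp
  · intro N hN M hM hNM
    simp only [Finset.coe_filter, Finset.mem_range, Set.mem_ofPred_eq] at hN hM
    refine Set.disjoint_left.2 fun Y hY hY' => hNM (bits_inj hN.1 hM.1 fun i hi => ?_)
    rw [← mem_cyl_prefixOf.1 hY i hi, mem_cyl_prefixOf.1 hY' i hi]

/-- The number of strings of length `L` that are accepted by `b`, when the strings are given by the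
binary expansions of the numbers below `2 ^ L`. -/
def numAccepted (b : Cantor → Bool) (L : ℕ) : ℕ :=
  ∑ N ∈ Finset.range (2 ^ L), (b (bits N)).toNat

/-- The approximation, scaled by `2 ^ m`, that `R` provides for the measure of the set of reals
whose initial segment of length `L` is accepted by `b`. -/
def countAccepted (R : Cantor) (b : Cantor → Bool) (L m : ℕ) : ℕ :=
  ∑ N ∈ Finset.range (2 ^ L), (b (bits N)).toNat * count R (prefixOf (bits N) L) m

theorem numAccepted_le (b : Cantor → Bool) (L : ℕ) : numAccepted b L ≤ 2 ^ L := by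
  calc numAccepted b L ≤ ∑ N ∈ Finset.range (2 ^ L), 1 :=
        Finset.sum_le_sum fun N _ => Bool.toNat_le _
    _ = 2 ^ L := by simp

theorem IsRepresentation.abs_countAccepted_sub_le {R : Cantor} {μ : Measure Cantor}
    [IsProbabilityMeasure μ] (hR : IsRepresentation cyl R μ) {b : Cantor → Bool} {L : ℕ}
    (h : ∀ Y Y', (∀ i < L, Y i = Y' i) → b Y = b Y') (m : ℕ) :
    |(countAccepted R b L m : ℝ) - 2 ^ m * μ.real {X | b X = true}| ≤ numAccepted b L := by
  rw [measureReal_eq_sum_cyl μ h, countAccepted, numAccepted, Finset.mul_sum]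
  push_cast
  rw [← Finset.sum_sub_distrib]
  refine (Finset.abs_sum_le_sum_abs _ _).trans (Finset.sum_le_sum fun N _ => ?_)
  have e : ((b (bits N)).toNat : ℝ) * (count R (prefixOf (bits N) L) m : ℝ) -
      2 ^ m * (((b (bits N)).toNat : ℝ) * μ.real (cyl (prefixOf (bits N) L))) =
      ((b (bits N)).toNat : ℝ) * ((count R (prefixOf (bits N) L) m : ℝ) -
        2 ^ m * μ.real (cyl (prefixOf (bits N) L))) := by ring
  rw [e, abs_mul, abs_of_nonneg (Nat.cast_nonneg _)]
  exact mul_le_of_le_one_right (Nat.cast_nonneg _) (hR.abs_count_sub_le _ _)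

theorem primrec_prefixOf_bits : Primrec₂ fun L N : ℕ => prefixOf (bits N) L :=
  (Primrec.list_map (Primrec.list_range.comp Primrec.fst) (g := fun (p : ℕ × ℕ) i => bits p.2 i)
    (primrec_testBit.comp (Primrec.snd.comp Primrec.fst) Primrec.snd).to₂).to₂

theorem OracleMap.const_bits : OracleMap fun (p : α × ℕ) _ => bits p.2 :=
  OracleMap.const (primrec_testBit.comp (Primrec.snd.comp Primrec.fst) Primrec.snd).to₂

theorem OraclePrimrec.numAccepted {f : α → Cantor → Bool} (hf : OraclePrimrec f) {L : α → ℕ}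
    (hL : Primrec L) {Φ : α → Cantor → Cantor} (hΦ : OracleMap Φ) :
    OraclePrimrec fun a Z => numAccepted (fun x => f a (join (Φ a Z) x)) (L a) :=
  OraclePrimrec.sum_range (primrec_two_pow.comp hL) ((hf.comp Primrec.fst).subst
    ((hΦ.comp Primrec.fst).join OracleMap.const_bits)).toNat

theorem OraclePrimrec.countAccepted {f : α → Cantor → Bool} (hf : OraclePrimrec f) {L m : α → ℕ}
    (hL : Primrec L) (hm : Primrec m) {Φ Ψ : α → Cantor → Cantor} (hΦ : OracleMap Φ)
    (hΨ : OracleMap Ψ) : OraclePrimrec fun a Z =>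
      countAccepted (Ψ a Z) (fun x => f a (join (Φ a Z) x)) (L a) (m a) := by
  have hc : Primrec fun p : α × ℕ => (prefixOf (bits p.2) (L p.1), m p.1) :=
    (primrec_prefixOf_bits.comp (hL.comp Primrec.fst) Primrec.snd).pair (hm.comp Primrec.fst)
  exact OraclePrimrec.sum_range (primrec_two_pow.comp hL) (((hf.comp Primrec.fst).subst
    ((hΦ.comp Primrec.fst).join OracleMap.const_bits)).toNat.mul
      ((OraclePrimrec.count.comp hc).subst (hΨ.comp Primrec.fst)))

theorem EffOpen.isOpen_section {P : α → Cantor → Prop} (hP : EffOpen P) (a : α) (Z : Cantor) :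
    IsOpen {x | P a (join Z x)} := by
  obtain ⟨f, u, -, -, hfu, -, h⟩ := hP.exists_stages
  simp only [h, Set.ofPred_exists]
  exact isOpen_iUnion fun s => isOpen_of_use (u (a, s)) fun Y Y' e =>
    hfu _ _ _ (join_congr_right Z e)

theorem ennreal_le_inv_two_pow_iff (μ : Measure Cantor) [IsProbabilityMeasure μ] (s : Set Cantor)
    (g : ℕ) : μ s ≤ (2 ^ g)⁻¹ ↔ μ.real s ≤ (2 ^ g : ℝ)⁻¹ := by
  have h : ((2 : ℝ≥0∞) ^ g)⁻¹ = ENNReal.ofReal ((2 ^ g : ℝ)⁻¹) := by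
    rw [ENNReal.ofReal_inv_of_pos (by positivity), ENNReal.ofReal_pow two_pos.le]
    simp
  rw [h, ← ofReal_measureReal, ENNReal.ofReal_le_ofReal_iff (by positivity)]

/-- An effectively open relation can be trimmed, uniformly in the representation `R` of a measure
`μ` and in the parameter `Z`, so that all its sections have `μ`-measure at most `2 ^ (-g a)`, while
the sections that have measure at most `2 ^ (-g a - 1)` to begin with lose nothing. -/
theorem EffOpen.exists_trim {P : α → Cantor → Prop} (hP : EffOpen P) {g : α → ℕ}
    (hg : Primrec g) : ∃ P' : α → Cantor → Prop, EffOpen P' ∧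
      ∀ (μ : Measure Cantor) [IsProbabilityMeasure μ] (R : Cantor), IsRepresentation cyl R μ →
        ∀ a Z, μ {x | P' a (join (join R Z) x)} ≤ (2 ^ g a)⁻¹ ∧
          (μ {x | P a (join Z x)} ≤ (2 ^ (g a + 1))⁻¹ →
            ∀ x, P a (join Z x) → P' a (join (join R Z) x)) := by
  obtain ⟨f, u, hf, hu, hfu, hmono, h⟩ := hP.exists_stages
  -- A stage is kept if the approximation from above to its measure that `R` provides at
  -- precision `m p` is below the bound.
  -- With `2 ^ u p` strings, the error is at most `2 ^ (u p + 1 - m p) = 2 ^ (-g p.1 - 2)`.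
  let m : α × ℕ → ℕ := fun p => u p + g p.1 + 3
  have hm : Primrec m := Primrec.nat_add.comp (Primrec.nat_add.comp hu (hg.comp Primrec.fst))
    (Primrec.const 3)
  let small : α × ℕ → Cantor → Cantor → Bool := fun p R Z =>
    decide (2 ^ g p.1 * (countAccepted R (fun x => f p (join Z x)) (u p) (m p) +
      numAccepted (fun x => f p (join Z x)) (u p)) < 2 ^ m p)
  have hR : OracleMap fun (_ : α × ℕ) Z => evens (evens Z) := OracleMap.id.evens.evens
  have hZ : OracleMap fun (_ : α × ℕ) Z => odds (evens Z) := OracleMap.id.evens.odds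
  have hsmall : OraclePrimrec fun p Z => small p (evens (evens Z)) (odds (evens Z)) :=
    ((OraclePrimrec.of_primrec (primrec_two_pow.comp (hg.comp Primrec.fst))).mul
      ((hf.countAccepted hu hm hZ hR).add (hf.numAccepted hu hZ))).lt
        (OraclePrimrec.of_primrec (primrec_two_pow.comp hm))
  have hacc : OraclePrimrec fun p Z => f p (join (odds (evens Z)) (odds Z)) :=
    hf.subst (hZ.join OracleMap.id.odds)
  refine ⟨fun a Z => ∃ s, (f (a, s) (join (odds (evens Z)) (odds Z)) &&
    small (a, s) (evens (evens Z)) (odds (evens Z))) = true, ⟨_, hacc.and hsmall, fun _ _ => Iff.rfl⟩,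
    fun μ _ R hRμ a Z => ?_⟩
  have hb : ∀ s Y Y', (∀ i < u (a, s), Y i = Y' i) →
      f (a, s) (join Z Y) = f (a, s) (join Z Y') :=
    fun s Y Y' e => hfu _ _ _ (join_congr_right Z e)
  have hmonoset : Monotone fun s => {x | f (a, s) (join Z x) = true} :=
    fun s t hst x => hmono a s t _ hst
  simp only [evens_join, odds_join, Bool.and_eq_true]
  have hap := fun s => abs_le.1 (hRμ.abs_countAccepted_sub_le (hb s) (m (a, s)))
  have hgpos : (0 : ℝ) < 2 ^ g a := by positivity
  constructor
  · have hset : {x | ∃ s, f (a, s) (join Z x) = true ∧ small (a, s) R Z = true} =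
        ⋃ s : {s // small (a, s) R Z = true}, {x | f (a, s.1) (join Z x) = true} := by
      ext x; simp [and_comm]
    rw [hset, (Monotone.directed_le fun s t hst => hmonoset hst : Directed (· ⊆ ·)
      fun s : {s // small (a, s) R Z = true} => {x | f (a, s.1) (join Z x) = true}).measure_iUnion]
    refine iSup_le fun ⟨s, hs⟩ => (ennreal_le_inv_two_pow_iff _ _ _).2 ?_
    have hs' : (2 : ℝ) ^ g a * (countAccepted R (fun x => f (a, s) (join Z x)) (u (a, s)) (m (a, s))
        + numAccepted (fun x => f (a, s) (join Z x)) (u (a, s))) < 2 ^ m (a, s) := by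
      exact_mod_cast of_decide_eq_true hs
    have h1 := (hap s).1
    have hmpos : (0 : ℝ) < 2 ^ m (a, s) := by positivity
    rw [← one_div, le_div_iff₀ hgpos]
    have h2 : 2 ^ g a * (2 ^ m (a, s) * μ.real {x | f (a, s) (join Z x) = true}) ≤
        (2 : ℝ) ^ m (a, s) := by
      refine le_trans ?_ hs'.le
      gcongr
      linarith
    nlinarith
  · intro hle x hx
    obtain ⟨s, hs⟩ := (h _ _).1 hx
    refine ⟨s, hs, decide_eq_true ?_⟩
    have hle' : μ.real {x | f (a, s) (join Z x) = true} ≤ (2 ^ (g a + 1) : ℝ)⁻¹ :=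
      (ennreal_le_inv_two_pow_iff _ _ _).1
        ((measure_mono fun y hy => (h _ _).2 ⟨s, hy⟩).trans hle)
    have hK : (numAccepted (fun x => f (a, s) (join Z x)) (u (a, s)) : ℝ) ≤ 2 ^ u (a, s) := by
      exact_mod_cast numAccepted_le _ _
    have h2 := (hap s).2
    have hmv : (2 : ℝ) ^ m (a, s) = 8 * (2 ^ g a * 2 ^ u (a, s)) := by
      simp only [m, pow_add]; ring
    have hmpos : (0 : ℝ) < 2 ^ m (a, s) := by positivity
    have h3 : (2 : ℝ) ^ m (a, s) * μ.real {x | f (a, s) (join Z x) = true} ≤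
        2 ^ m (a, s) * (2 ^ (g a + 1))⁻¹ := by gcongr
    have h4 : (2 : ℝ) ^ m (a, s) * (2 ^ (g a + 1))⁻¹ = 4 * 2 ^ u (a, s) := by
      rw [hmv, pow_succ]; field_simp; ring
    have hupos : (0 : ℝ) < 2 ^ u (a, s) := by positivity
    have h5 : (2 : ℝ) ^ g a * (countAccepted R (fun x => f (a, s) (join Z x)) (u (a, s)) (m (a, s))
        + numAccepted (fun x => f (a, s) (join Z x)) (u (a, s))) < 2 ^ m (a, s) := by
      rw [hmv]
      have : (countAccepted R (fun x => f (a, s) (join Z x)) (u (a, s)) (m (a, s))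
        + numAccepted (fun x => f (a, s) (join Z x)) (u (a, s)) : ℝ) < 8 * 2 ^ u (a, s) := by
        linarith
      calc _ < (2 : ℝ) ^ g a * (8 * 2 ^ u (a, s)) := by gcongr
        _ = _ := by ring
    exact_mod_cast h5

/-- From a representation of `μ` it can be enumerated that a section of an effectively open
relation has measure greater than `2 ^ (-g a)`. -/
theorem EffOpen.measure_section_gt {P : α → Cantor → Prop} (hP : EffOpen P) {g : α → ℕ}
    (hg : Primrec g) : ∃ P' : α → Cantor → Prop, EffOpen P' ∧
      ∀ (μ : Measure Cantor) [IsProbabilityMeasure μ] (R : Cantor), IsRepresentation cyl R μ →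
        ∀ a Z, P' a (join R Z) ↔ (2 ^ g a)⁻¹ < μ {x | P a (join Z x)} := by
  obtain ⟨f, u, hf, hu, hfu, hmono, h⟩ := hP.exists_stages
  let big : (α × ℕ) × ℕ → Cantor → Cantor → Bool := fun p R Z =>
    decide (2 ^ p.2 + 2 ^ g p.1.1 * numAccepted (fun x => f p.1 (join Z x)) (u p.1) <
      2 ^ g p.1.1 * countAccepted R (fun x => f p.1 (join Z x)) (u p.1) p.2)
  have hf' : OraclePrimrec fun p : (α × ℕ) × ℕ => f p.1 := hf.comp Primrec.fst
  have hu' : Primrec fun p : (α × ℕ) × ℕ => u p.1 := hu.comp Primrec.fst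
  have hR : OracleMap fun (_ : (α × ℕ) × ℕ) Z => evens Z := OracleMap.id.evens
  have hZ : OracleMap fun (_ : (α × ℕ) × ℕ) Z => odds Z := OracleMap.id.odds
  have hgp : OraclePrimrec fun (p : (α × ℕ) × ℕ) (_ : Cantor) => 2 ^ g p.1.1 :=
    OraclePrimrec.of_primrec
      (primrec_two_pow.comp (hg.comp (Primrec.fst.comp Primrec.fst)))
  have hbig : OraclePrimrec fun p Z => big p (evens Z) (odds Z) :=
    ((OraclePrimrec.of_primrec (primrec_two_pow.comp Primrec.snd)).add
      (hgp.mul (hf'.numAccepted hu' hZ))).lt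
        (hgp.mul (hf'.countAccepted hu' Primrec.snd hZ hR))
  refine ⟨_, (EffOpen.of_bool hbig).exists'.exists', fun μ _ R hRμ a Z => ?_⟩
  have hb : ∀ s Y Y', (∀ i < u (a, s), Y i = Y' i) →
      f (a, s) (join Z Y) = f (a, s) (join Z Y') :=
    fun s Y Y' e => hfu _ _ _ (join_congr_right Z e)
  have hap := fun s m => abs_le.1 (hRμ.abs_countAccepted_sub_le (hb s) m)
  have hgpos : (0 : ℝ) < 2 ^ g a := by positivity
  have hlt : (2 ^ g a)⁻¹ < μ {x | P a (join Z x)} ↔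
      ∃ s, (2 ^ g a : ℝ)⁻¹ < μ.real {x | f (a, s) (join Z x) = true} := by
    have hset : {x | P a (join Z x)} = ⋃ s, {x | f (a, s) (join Z x) = true} := by
      ext x; simp [h]
    have hmonoset : Monotone fun s => {x | f (a, s) (join Z x) = true} :=
      fun s t hst x => hmono a s t _ hst
    rw [hset, hmonoset.measure_iUnion, lt_iSup_iff]
    exact exists_congr fun s => by
      rw [← not_le, ← not_le, ennreal_le_inv_two_pow_iff]
  rw [hlt]
  simp only [evens_join, odds_join, big, decide_eq_true_eq]
  refine exists_congr fun s => ⟨?_, fun hs => ?_⟩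
  · rintro ⟨m, hm⟩
    have hm' : (2 : ℝ) ^ m + 2 ^ g a * numAccepted (fun x => f (a, s) (join Z x)) (u (a, s)) <
        2 ^ g a * countAccepted R (fun x => f (a, s) (join Z x)) (u (a, s)) m := by
      exact_mod_cast hm
    have h2 := (hap s m).2
    have hmpos : (0 : ℝ) < 2 ^ m := by positivity
    rw [← one_div, div_lt_iff₀ hgpos]
    have h3 : (2 : ℝ) ^ m < 2 ^ g a * (2 ^ m * μ.real {x | f (a, s) (join Z x) = true}) := by
      have : 2 ^ g a * (countAccepted R (fun x => f (a, s) (join Z x)) (u (a, s)) m -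
        numAccepted (fun x => f (a, s) (join Z x)) (u (a, s)) : ℝ) ≤
          2 ^ g a * (2 ^ m * μ.real {x | f (a, s) (join Z x) = true}) := by
        gcongr; linarith
      linarith
    by_contra hcon
    push Not at hcon
    nlinarith
  · set r := μ.real {x | f (a, s) (join Z x) = true} with hr
    have hpos : 0 < 2 ^ g a * r - 1 := by
      rw [← one_div, div_lt_iff₀ hgpos] at hs
      linarith
    obtain ⟨m, hm⟩ := pow_unbounded_of_one_lt
      (2 ^ g a * (2 * 2 ^ u (a, s)) / (2 ^ g a * r - 1)) (one_lt_two (α := ℝ))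
    refine ⟨m, ?_⟩
    rw [div_lt_iff₀ hpos] at hm
    have hK : (numAccepted (fun x => f (a, s) (join Z x)) (u (a, s)) : ℝ) ≤ 2 ^ u (a, s) := by
      exact_mod_cast numAccepted_le _ _
    have h1 := (hap s m).1
    have h5 : (2 : ℝ) ^ m + 2 ^ g a * numAccepted (fun x => f (a, s) (join Z x)) (u (a, s)) <
        2 ^ g a * countAccepted R (fun x => f (a, s) (join Z x)) (u (a, s)) m := by
      have : 2 ^ g a * (2 ^ m * r - 2 ^ u (a, s) : ℝ) ≤
          2 ^ g a * countAccepted R (fun x => f (a, s) (join Z x)) (u (a, s)) m := by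
        gcongr; linarith
      have : (2 : ℝ) ^ g a * numAccepted (fun x => f (a, s) (join Z x)) (u (a, s)) ≤
          2 ^ g a * 2 ^ u (a, s) := by gcongr
      linarith
    exact_mod_cast h5

end

/-! ### Computing representations from representations -/

section
variable {ι ι' E E' : Type} [Primcodable ι] [Primcodable ι']

/-- The position at which a representation for basic sets indexed by `ι` has to be read to
obtain bit `i` of a representation for the basic sets `φ c'`. -/
def relabelIndex (φ : ι' → ι) (i : ℕ) : ℕ :=
  ((Encodable.decode (α := ι' × ℕ × ℕ) i).map fun p =>
    Encodable.encode (φ p.1, p.2.1, p.2.2)).getD 0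

/-- The representation whose blocks for `c'` are the blocks of `R` for `φ c'`. -/
def relabel (φ : ι' → ι) (R : Cantor) : Cantor := fun i => R (relabelIndex φ i)

theorem primrec_relabelIndex {φ : ι' → ι} (hφ : Primrec φ) : Primrec (relabelIndex φ) :=
  Primrec.option_getD.comp (Primrec.option_map Primrec.decode
    (Primrec.encode.comp ((hφ.comp (Primrec.fst.comp Primrec.snd)).pair
      ((Primrec.fst.comp (Primrec.snd.comp Primrec.snd)).pair
        (Primrec.snd.comp (Primrec.snd.comp Primrec.snd))))).to₂) (Primrec.const 0)

theorem OracleMap.relabel {α : Type} [Primcodable α] {Φ : α → Cantor → Cantor}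
    (hΦ : OracleMap Φ) {φ : ι' → ι} (hφ : Primrec φ) : OracleMap fun a Z => relabel φ (Φ a Z) :=
  hΦ.reindex (primrec_relabelIndex hφ)

theorem IsRepresentation.relabel [MeasurableSpace E] [MeasurableSpace E'] {B : ι → Set E}
    {B' : ι' → Set E'} {R : Cantor} {μ : Measure E} {μ' : Measure E'}
    (hR : IsRepresentation B R μ) {φ : ι' → ι} (h : ∀ c, μ' (B' c) = μ (B (φ c))) :
    IsRepresentation B' (relabel φ R) μ' := fun c n => by
  have e : approx (MLRandom.relabel φ R) c n = approx R (φ c) n := by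
    simp [approx, MLRandom.relabel, relabelIndex, -Encodable.encode_prod_val,
      -Encodable.decode_prod_val]
  rw [e, measureReal_def, h c]
  exact hR (φ c) n

end

theorem measurable_join : Measurable fun p : Cantor × Cantor => join p.1 p.2 := by
  refine measurable_pi_iff.2 fun i => ?_
  simp only [join]
  split_ifs
  · exact (measurable_pi_apply _).comp measurable_fst
  · exact (measurable_pi_apply _).comp measurable_snd

theorem EffOpen.measurableSet_join {α : Type} [Primcodable α] {P : α → Cantor → Prop}
    (hP : EffOpen P) (a : α) (Z : Cantor) :
    MeasurableSet {p : Cantor × Cantor | P a (join Z (join p.1 p.2))} :=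
  measurable_join (hP.isOpen_section a Z).measurableSet

/-- The strings of the bits of `s` in even and in odd positions. -/
def unjoin (s : List Bool) : List Bool × List Bool :=
  (prefixOf (evens (pad s)) ((s.length + 1) / 2), prefixOf (odds (pad s)) (s.length / 2))

theorem primrec_unjoin : Primrec unjoin := by
  have hlen : Primrec fun s : List Bool => s.length := Primrec.list_length
  refine Primrec.pair (Primrec.list_map (Primrec.list_range.comp (Primrec.nat_div.comp
    (Primrec.succ.comp hlen) (Primrec.const 2))) (g := fun s i => evens (pad s) i) ?_)
    (Primrec.list_map (Primrec.list_range.comp (Primrec.nat_div.comp hlen (Primrec.const 2)))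
    (g := fun s i => odds (pad s) i) ?_)
  · exact (primrec_pad.comp Primrec.fst (Primrec.nat_double.comp Primrec.snd)).to₂
  · exact (primrec_pad.comp Primrec.fst (Primrec.nat_double_succ.comp Primrec.snd)).to₂

theorem preimage_join_cyl (s : List Bool) :
    (fun p : Cantor × Cantor => join p.1 p.2) ⁻¹' cyl s = cyl₂ (unjoin s) := by
  ext ⟨X, Y⟩
  simp only [cyl₂, unjoin, Set.mem_preimage, Set.mem_prod, mem_cyl_prefixOf]
  change IsInitSeg s _ ↔ _
  rw [isInitSeg_iff_pad]
  constructor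
  · intro h
    constructor
    · intro i hi
      rw [← evens_join X Y]
      exact h _ (by omega)
    · intro i hi
      rw [← odds_join X Y]
      exact h _ (by omega)
  · rintro ⟨h1, h2⟩ i hi
    rcases Nat.mod_two_eq_zero_or_one i with e | e
    · have := h1 (i / 2) (by omega)
      simp only [join, e, if_true, this, evens]
      congr 1; omega
    · have := h2 (i / 2) (by omega)
      simp only [join, e, one_ne_zero, if_false, this, odds]
      congr 1; omega

theorem isRepresentation_map_join {ν : Measure (Cantor × Cantor)} {R : Cantor}
    (hR : IsRepresentation cyl₂ R ν) :
    IsRepresentation cyl (relabel unjoin R) (ν.map fun p => join p.1 p.2) :=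
  hR.relabel fun s => by
    rw [Measure.map_apply measurable_join (measurableSet_cyl s), preimage_join_cyl]

theorem isRepresentation_fst {μ : Measure Cantor} [IsProbabilityMeasure μ] {R : Cantor}
    (hR : IsRepresentation cyl₂ R (μ.prod μ)) :
    IsRepresentation cyl (relabel (fun σ : List Bool => (σ, ([] : List Bool))) R) μ :=
  hR.relabel fun s => by
    have : cyl [] = Set.univ := Set.eq_univ_of_forall fun X i h => absurd h (Nat.not_lt_zero i)
    rw [cyl₂, Measure.prod_prod, this, measure_univ, mul_one]

theorem abs_mul_sub_mul_le {x y p q ε : ℝ} (hx : |x - p| ≤ ε) (hy : |y - q| ≤ ε)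
    (hx1 : |x| ≤ 1) (hq1 : |q| ≤ 1) : |x * y - p * q| ≤ 2 * ε := by
  have e : x * y - p * q = x * (y - q) + (x - p) * q := by ring
  rw [e]
  refine (abs_add_le _ _).trans ?_
  rw [abs_mul, abs_mul]
  have h1 := mul_le_mul hx1 hy (abs_nonneg _) zero_le_one
  have h2 := mul_le_mul hx hq1 (abs_nonneg _) ((abs_nonneg _).trans hx)
  linarith

/-- The representations of `μ × μ` form a `Π⁰₁` class relative to any representation of `μ`. -/
theorem exists_effOpen_not_isRepresentation : ∃ P : Unit → Cantor → Prop, EffOpen P ∧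
    ∀ (μ : Measure Cantor) [IsProbabilityMeasure μ] (S R : Cantor), IsRepresentation cyl S μ →
      (P () (join S R) ↔ ¬ IsRepresentation cyl₂ R (μ.prod μ)) := by
  -- `R` is refuted by `(c, n, m)` if its approximation to the measure of `c` with error `2 ^ (-n)`
  -- is too far from the product of the approximations from `S` with error `2 ^ (-m)`. The inequality
  -- is multiplied by `2 ^ n * 4 ^ m` to stay within the natural numbers.
  let Ix := (Unit × (List Bool × List Bool)) × (ℕ × ℕ)
  let l : Ix → Cantor → ℕ := fun p Z =>
    count (odds Z) p.1.2 p.2.1 * (2 ^ p.2.2 * 2 ^ p.2.2)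
  let r : Ix → Cantor → ℕ := fun p Z =>
    count (evens Z) p.1.2.1 p.2.2 * count (evens Z) p.1.2.2 p.2.2 * 2 ^ p.2.1
  let err : Ix → Cantor → ℕ := fun p _ =>
    2 ^ p.2.2 * 2 ^ p.2.2 + 2 * (2 ^ p.2.2 * 2 ^ p.2.1)
  let K : Ix → Cantor → Bool := fun p Z =>
    decide (r p Z + err p Z < l p Z) || decide (l p Z + err p Z < r p Z)
  have hc : Primrec fun p : Ix => p.1.2 := Primrec.snd.comp Primrec.fst
  have hn : Primrec fun p : Ix => p.2.1 := Primrec.fst.comp Primrec.snd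
  have hm : Primrec fun p : Ix => p.2.2 := Primrec.snd.comp Primrec.snd
  have h2n : OraclePrimrec fun (p : Ix) (_ : Cantor) => 2 ^ p.2.1 :=
    OraclePrimrec.of_primrec (primrec_two_pow.comp hn)
  have h2m : OraclePrimrec fun (p : Ix) (_ : Cantor) => 2 ^ p.2.2 :=
    OraclePrimrec.of_primrec (primrec_two_pow.comp hm)
  have hl : OraclePrimrec l :=
    ((OraclePrimrec.count.comp (hc.pair hn)).subst OracleMap.id.odds).mul (h2m.mul h2m)
  have hr : OraclePrimrec r :=
    (((OraclePrimrec.count.comp ((Primrec.fst.comp hc).pair hm)).subst OracleMap.id.evens).mul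
      ((OraclePrimrec.count.comp ((Primrec.snd.comp hc).pair hm)).subst OracleMap.id.evens)).mul h2n
  have herr : OraclePrimrec err :=
    (h2m.mul h2m).add ((OraclePrimrec.of_primrec (Primrec.const 2)).mul (h2m.mul h2n))
  have hK : OraclePrimrec K :=
    OraclePrimrec.map₂ Primrec.or ((hr.add herr).lt hl) ((hl.add herr).lt hr)
  refine ⟨_, (EffOpen.of_bool hK).exists'.exists', fun μ _ S R hS => ?_⟩
  have key : ∀ (c : List Bool × List Bool) (n m : ℕ), K (((), c), (n, m)) (join S R) = true ↔
      (2 ^ n : ℝ)⁻¹ + 2 * (2 ^ m : ℝ)⁻¹ <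
        |(approx R c n : ℝ) - approx S c.1 m * approx S c.2 m| := by
    intro c n m
    have hn : (0 : ℝ) < 2 ^ n := by positivity
    have hm : (0 : ℝ) < 2 ^ m := by positivity
    have eR : (approx R c n : ℝ) = count R c n / 2 ^ n := by simp [approx, count]
    have eS : ∀ σ : List Bool, (approx S σ m : ℝ) = count S σ m / 2 ^ m := fun σ => by
      simp [approx, count]
    have e1 : (approx R c n : ℝ) - approx S c.1 m * approx S c.2 m =
        (count R c n * (2 ^ m * 2 ^ m) - count S c.1 m * count S c.2 m * 2 ^ n) /
          (2 ^ n * (2 ^ m * 2 ^ m)) := by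
      rw [eR, eS, eS]; field_simp
    have e2 : (2 ^ n : ℝ)⁻¹ + 2 * (2 ^ m : ℝ)⁻¹ =
        (2 ^ m * 2 ^ m + 2 * (2 ^ m * 2 ^ n)) / (2 ^ n * (2 ^ m * 2 ^ m)) := by
      field_simp
    have hd : (0 : ℝ) < 2 ^ n * (2 ^ m * 2 ^ m) := by positivity
    rw [e1, e2, abs_div, abs_of_pos hd, div_lt_div_iff_of_pos_right hd, lt_abs]
    simp only [K, l, r, err, evens_join, odds_join, Bool.or_eq_true, decide_eq_true_eq]
    rw [← Nat.cast_lt (α := ℝ), ← Nat.cast_lt (α := ℝ)]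
    push_cast
    constructor
    · rintro (h | h)
      · left; linarith
      · right; linarith
    · rintro (h | h)
      · left; linarith
      · right; linarith
  have hprod : ∀ (c : List Bool × List Bool) (m : ℕ),
      |(approx S c.1 m : ℝ) * approx S c.2 m - (μ.prod μ).real (cyl₂ c)| ≤ 2 * (2 ^ m : ℝ)⁻¹ := by
    intro c m
    rw [cyl₂, measureReal_prod_prod]
    refine abs_mul_sub_mul_le (hS c.1 m) (hS c.2 m) ?_ ?_
    · have hm : (0 : ℝ) < 2 ^ m := by positivity
      have e : (approx S c.1 m : ℝ) = count S c.1 m / 2 ^ m := by simp [approx, count]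
      rw [e, abs_of_nonneg (by positivity), div_le_one hm]
      exact_mod_cast count_le S c.1 m
    · rw [abs_of_nonneg measureReal_nonneg]
      exact measureReal_le_one
  constructor
  · rintro ⟨c, ⟨n, m⟩, h⟩ hR
    have h1 := (key c n m).1 h
    have h2 := abs_sub_le (approx R c n : ℝ) ((μ.prod μ).real (cyl₂ c))
      (approx S c.1 m * approx S c.2 m)
    have h3 := hR c n
    have h4 := hprod c m
    rw [abs_sub_comm] at h4
    linarith
  · intro h
    simp only [IsRepresentation, not_forall, not_le] at h
    obtain ⟨c, n, h⟩ := h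
    obtain ⟨m, hm⟩ := exists_pow_lt_of_lt_one (div_pos (sub_pos.2 h) (four_pos (α := ℝ)))
      (one_half_lt_one (α := ℝ))
    refine ⟨c, (n, m), (key c n m).2 ?_⟩
    have h2 := abs_sub_le (approx R c n : ℝ) (approx S c.1 m * approx S c.2 m)
      ((μ.prod μ).real (cyl₂ c))
    have h4 := hprod c m
    rw [one_div, inv_pow, lt_div_iff₀ four_pos] at hm
    linarith

/-! ### Tests on the product space and their sections -/

theorem tsum_inv_two_pow (k : ℕ) : ∑' m : ℕ, ((2 : ℝ≥0∞) ^ (k + 1 + m))⁻¹ = (2 ^ k)⁻¹ := by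
  have e : ∀ m : ℕ, ((2 : ℝ≥0∞) ^ (k + 1 + m))⁻¹ = (2 ^ k)⁻¹ * (2⁻¹ * 2⁻¹ ^ m) := fun m => by
    rw [← pow_succ', ← ENNReal.inv_pow, ← ENNReal.mul_inv (by simp) (by simp), ← pow_add]
    congr 2; ring
  simp_rw [e]
  rw [ENNReal.tsum_mul_left, ENNReal.tsum_mul_left, ENNReal.tsum_geometric,
    ENNReal.one_sub_inv_two, inv_inv, ENNReal.inv_mul_cancel (by simp) (by simp), mul_one]

theorem OracleMap.emptyReal {α : Type} [Primcodable α] : OracleMap fun (_ : α) _ => emptyReal :=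
  OracleMap.const (q := fun _ => MLRandom.emptyReal) (Primrec.const false).to₂

/-- There is a universal test on the product space, uniform in the measure `ν` and in its
representation `R`: the union of all recursively enumerable sequences, each trimmed. The trimming
is done on `2^ω` for the image of `ν` under the join. -/
theorem exists_universal_test : ∃ U : ℕ → Cantor → Prop, EffOpen U ∧
    ∀ (ν : Measure (Cantor × Cantor)) [IsProbabilityMeasure ν] (R : Cantor),
      IsRepresentation cyl₂ R ν →
        (∀ n, ν {p | U n (join R (join p.1 p.2))} ≤ (2 ^ (2 * n))⁻¹) ∧
        ∀ p, ¬ IsRandomFor cyl₂ ν R emptyReal p → ∀ n, U n (join R (join p.1 p.2)) := by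
  obtain ⟨P, hP, hPuniv⟩ := isPresentation_cyl₂.exists_universal
  -- The `e`-th test contributes its component `2 * n + e + 2` to the `n`-th component.
  have h2n : Primrec fun a : ℕ × ℕ => 2 * a.1 + a.2 :=
    Primrec.nat_add.comp (Primrec.nat_double.comp Primrec.fst) Primrec.snd
  have hg : Primrec fun a : ℕ × ℕ => 2 * a.1 + a.2 + 1 := Primrec.succ.comp h2n
  have hidx : Primrec fun a : ℕ × ℕ => (a.2, 2 * a.1 + a.2 + 1 + 1) :=
    Primrec.snd.pair (Primrec.succ.comp hg)
  obtain ⟨P', hP', htrim⟩ := (hP.comp hidx).exists_trim hg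
  have hev : OracleMap fun (_ : ℕ × ℕ) Z => evens Z := OracleMap.id.evens
  have hU := (hP'.subst (((hev.relabel primrec_unjoin).join
    (hev.join OracleMap.emptyReal)).join OracleMap.id.odds)).exists'
  refine ⟨_, hU, fun ν _ R hR => ?_⟩
  have hlam : IsProbabilityMeasure (ν.map fun p : Cantor × Cantor => join p.1 p.2) :=
    Measure.isProbabilityMeasure_map measurable_join.aemeasurable
  have htr := htrim _ _ (isRepresentation_map_join hR)
  have hmap : ∀ {Q : ℕ × ℕ → Cantor → Prop} (_ : EffOpen Q) a Z,
      (ν.map fun p : Cantor × Cantor => join p.1 p.2) {x | Q a (join Z x)} =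
        ν {p | Q a (join Z (join p.1 p.2))} := fun hQ a Z =>
    Measure.map_apply measurable_join (hQ.isOpen_section a Z).measurableSet
  simp only [evens_join, odds_join]
  constructor
  · intro n
    have hset : {p : Cantor × Cantor | ∃ e, P' (n, e)
        (join (join (relabel unjoin R) (join R emptyReal)) (join p.1 p.2))} =
        ⋃ e, {p : Cantor × Cantor | P' (n, e)
          (join (join (relabel unjoin R) (join R emptyReal)) (join p.1 p.2))} := by
      ext; simp
    rw [hset, ← tsum_inv_two_pow]
    refine (measure_iUnion_le _).trans (ENNReal.tsum_le_tsum fun e => ?_)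
    rw [← hmap hP', show 2 * n + 1 + e = 2 * n + e + 1 by ring]
    exact (htr (n, e) (join R emptyReal)).1
  · intro p hp n
    simp only [IsRandomFor, not_forall, not_not] at hp
    obtain ⟨V, ⟨hVσ, hVm⟩, hpV⟩ := hp
    obtain ⟨e, he⟩ := hPuniv _ _ hVσ
    refine ⟨e, (htr (n, e) (join R emptyReal)).2 ?_ _ ((he _ _).1 (Set.mem_iInter.1 hpV _))⟩
    rw [hmap (hP.comp hidx)]
    refine le_trans (measure_mono fun q hq => ?_) (hVm (2 * n + e + 1 + 1))
    exact (he _ _).2 hq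

/-- A test with respect to `μ × μ`, uniform in a representation `S` of `μ` and independent of
the choice of `S`, which captures all pairs that are not random. It is the intersection of the
universal tests for all representations `R` of `μ × μ`, which form a compact class. -/
theorem exists_uniform_test : ∃ Q : ℕ → Cantor → Prop, EffOpen Q ∧
    ∀ (μ : Measure Cantor) [IsProbabilityMeasure μ],
      (∀ S, IsRepresentation cyl S μ → ∀ n,
        (μ.prod μ) {p | Q n (join S (join p.1 p.2))} ≤ (2 ^ (2 * n))⁻¹) ∧
      (∀ S S', IsRepresentation cyl S μ → IsRepresentation cyl S' μ → ∀ n x,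
        Q n (join S x) ↔ Q n (join S' x)) ∧
      ∀ p ∉ MLR₂ (μ.prod μ) emptyReal, ∀ S, IsRepresentation cyl S μ →
        ∀ n, Q n (join S (join p.1 p.2)) := by
  obtain ⟨U, hU, hUtest⟩ := exists_universal_test
  obtain ⟨N, hN, hNrep⟩ := exists_effOpen_not_isRepresentation
  have hod : OracleMap fun (_ : ℕ) Z => odds Z := OracleMap.id.odds
  have hev : OracleMap fun (_ : ℕ) Z => evens Z := OracleMap.id.evens
  have hQ := (((hN.comp (Primrec.const () : Primrec fun _ : ℕ => ())).subst
    (hev.evens.join hod)).or (hU.subst (hod.join hev.odds))).forall_real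
  refine ⟨_, hQ, fun μ _ => ?_⟩
  simp only [evens_join, odds_join]
  have hiff : ∀ S, IsRepresentation cyl S μ → ∀ n x,
      (∀ R, N () (join S R) ∨ U n (join R x)) ↔
        ∀ R, IsRepresentation cyl₂ R (μ.prod μ) → U n (join R x) := fun S hS n x =>
    forall_congr' fun R => by rw [hNrep μ S R hS, ← imp_iff_not_or]
  refine ⟨fun S hS n => ?_, fun S S' hS hS' n x => ?_, fun p hp S hS n => ?_⟩
  · obtain ⟨R, hR⟩ := exists_isRepresentation cyl₂ (μ.prod μ)
    exact (measure_mono fun p hp => (hiff S hS n _).1 hp R hR).trans ((hUtest _ R hR).1 n)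
  · rw [hiff S hS, hiff S' hS']
  · refine (hiff S hS n _).2 fun R hR => (hUtest _ R hR).2 p (fun h => hp ⟨R, hR, h⟩) n

/-- If the components of a pair are successively random, the pair is random. -/
theorem mem_MLR₂_of_mem_MLR {μ : Measure Cantor} [IsProbabilityMeasure μ] {A B : Cantor}
    (hA : A ∈ MLR μ emptyReal) (hB : B ∈ MLR μ A) : (A, B) ∈ MLR₂ (μ.prod μ) emptyReal := by
  by_contra hAB
  obtain ⟨S, hS, hAS⟩ := hA
  obtain ⟨S', hS', hBS'⟩ := hB
  obtain ⟨Q, hQ, hQtest⟩ := exists_uniform_test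
  obtain ⟨hQm, hQind, hQcap⟩ := hQtest μ
  have hev : OracleMap fun (_ : ℕ) Z => evens Z := OracleMap.id.evens
  have hod : OracleMap fun (_ : ℕ) Z => odds Z := OracleMap.id.odds
  have hQ' := hQ.subst (hev.evens.join (hev.odds.join hod))
  obtain ⟨G, hG, hGm⟩ := hQ'.measure_section_gt Primrec.id
  have hGiff : ∀ X n, G n (join S (join S X)) ↔
      (2 ^ n)⁻¹ < μ {Y | Q n (join S (join X Y))} := fun X n => by
    rw [hGm μ S hS n]
    simp
  -- By Markov's inequality, the points with a section of `Q n` of measure more than `2 ^ (-n)`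
  -- have measure at most `2 ^ (-n)`, since `Q n` has measure at most `2 ^ (-2 * n)`.
  have hGle : ∀ n, μ {X | G n (join S (join S X))} ≤ (2 ^ n)⁻¹ := by
    intro n
    have hmeas := hQ.measurableSet_join n S
    have h1 := hQm S hS n
    rw [Measure.prod_apply hmeas] at h1
    have h2 := (mul_meas_ge_le_lintegral (μ := μ) (measurable_measure_prodMk_left hmeas)
      ((2 ^ n)⁻¹)).trans h1
    have h3 : ((2 : ℝ≥0∞) ^ n)⁻¹ * μ {X | G n (join S (join S X))} ≤ (2 ^ n)⁻¹ * (2 ^ n)⁻¹ := by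
      rw [← ENNReal.mul_inv (by simp) (by simp), ← pow_add, ← two_mul]
      refine le_trans (mul_le_mul_right (measure_mono fun X hX => ?_) _) h2
      exact ((hGiff X n).1 hX).le
    exact (ENNReal.mul_le_mul_iff_right (by simp) (by simp)).1 h3
  -- The unions of the tails form a test, which `A` passes.
  have htail : EffOpen fun (k : ℕ) Z => ∃ m, G (k + 1 + m) (join (evens (evens Z))
      (join (evens (evens Z)) (odds Z))) :=
    ((hG.comp (Primrec.nat_add.comp (Primrec.succ.comp Primrec.fst) Primrec.snd)).subst
      ((hev.evens.join (hev.evens.join hod)).comp (Primrec.fst (α := ℕ) (β := ℕ)))).exists'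
  have hlarge : ∃ k, ∀ m, ¬ G (k + 1 + m) (join S (join S A)) := by
    by_contra hcon
    push Not at hcon
    refine hAS _ ⟨isPresentation_cyl.uniformlySigma01 htail (join S emptyReal), fun k => ?_⟩
      (Set.mem_iInter.2 fun k => ?_)
    · simp only [evens_join, odds_join, Set.ofPred_exists]
      rw [← tsum_inv_two_pow]
      exact (measure_iUnion_le _).trans (ENNReal.tsum_le_tsum fun m => hGle _)
    · simpa using hcon k
  obtain ⟨k, hk⟩ := hlarge
  -- From some index on, the sections at `A` form a test relative to `A`, and one that does not
  -- depend on the representation.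
  refine hBS' _ ⟨isPresentation_cyl.uniformlySigma01 (hQ'.comp (Primrec.nat_add.comp
    (Primrec.const (k + 1)) Primrec.id)) (join S' A), fun m => ?_⟩ (Set.mem_iInter.2 fun m => ?_)
  · have h1 := hk m
    rw [hGiff, not_lt] at h1
    simp only [evens_join, odds_join, id, hQind S' S hS' hS]
    refine h1.trans (ENNReal.inv_le_inv.2 (pow_le_pow_right₀ one_le_two ?_))
    omega
  · simpa using hQcap (A, B) hAB S' hS' _

/-- The components of a random pair are successively random. -/
theorem mem_MLR_of_mem_MLR₂ {μ : Measure Cantor} [IsProbabilityMeasure μ] {A B : Cantor}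
    (h : (A, B) ∈ MLR₂ (μ.prod μ) emptyReal) : A ∈ MLR μ emptyReal ∧ B ∈ MLR μ A := by
  obtain ⟨R, hR, hAB⟩ := h
  have hS := isRepresentation_fst hR
  set φ : List Bool → List Bool × List Bool := fun σ => (σ, [])
  have hφ : Primrec φ := Primrec.id.pair (Primrec.const [])
  have hfix : ∀ e : ℕ, Primrec fun n : ℕ => (e, n) := fun e => (Primrec.const e).pair Primrec.id
  have hev : OracleMap fun (_ : ℕ) Z => evens Z := OracleMap.id.evens
  have hod : OracleMap fun (_ : ℕ) Z => odds Z := OracleMap.id.odds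
  have hSm : OracleMap fun (_ : ℕ) Z => relabel φ (evens (evens Z)) := hev.evens.relabel hφ
  obtain ⟨P, hP, hPuniv⟩ := isPresentation_cyl.exists_universal
  refine ⟨⟨relabel φ R, hS, fun V ⟨hVσ, hVm⟩ hAV => ?_⟩,
    ⟨relabel φ R, hS, fun V ⟨hVσ, hVm⟩ hBV => ?_⟩⟩
  · obtain ⟨e, he⟩ := hPuniv _ _ hVσ
    have hT := (hP.comp (hfix e)).subst ((hSm.join OracleMap.emptyReal).join hod.evens)
    refine hAB _ ⟨isPresentation_cyl₂.uniformlySigma01 hT (join R emptyReal), fun n => ?_⟩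
      (Set.mem_iInter.2 fun n => ?_)
    · simp only [evens_join, odds_join, ← he]
      have hset : {p : Cantor × Cantor | p.1 ∈ V n} = V n ×ˢ Set.univ := by ext; simp
      rw [hset, Measure.prod_prod, measure_univ, mul_one]
      exact hVm n
    · simpa [← he] using Set.mem_iInter.1 hAV n
  · obtain ⟨e, he⟩ := hPuniv _ _ hVσ
    -- Trimming makes the sections small at every `X`, not only at `A`.
    obtain ⟨P', hP', htrim⟩ := (hP.comp ((hfix e).comp Primrec.succ)).exists_trim Primrec.id
    have hT := hP'.subst ((hSm.join (hSm.join hod.evens)).join hod.odds)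
    have htr := htrim μ _ hS
    refine hAB _ ⟨isPresentation_cyl₂.uniformlySigma01 hT (join R emptyReal), fun n => ?_⟩
      (Set.mem_iInter.2 fun n => ?_)
    · have hmeas := hT.measurableSet_join n (join R emptyReal)
      rw [Measure.prod_apply hmeas]
      calc _ ≤ ∫⁻ _, (2 ^ n)⁻¹ ∂μ := lintegral_mono fun X => ?_
        _ = (2 ^ n)⁻¹ := by simp
      simpa using (htr n (join (relabel φ R) X)).1
    · have hle : μ {x | P (e, n + 1) (join (join (relabel φ R) A) x)} ≤ (2 ^ (n + 1))⁻¹ := by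
        simpa [← he] using hVm (n + 1)
      simpa using (htr n (join (relabel φ R) A)).2 hle B
        ((he _ _).1 (Set.mem_iInter.1 hBV (n + 1)))

end MLRandom

theorem mainTheorem3 (μ : MeasureTheory.Measure MLRandom.Cantor)
    [MeasureTheory.IsProbabilityMeasure μ] (A B : MLRandom.Cantor) :
    (A, B) ∈ MLRandom.MLR₂ (μ.prod μ) MLRandom.emptyReal ↔
      A ∈ MLRandom.MLR μ MLRandom.emptyReal ∧ B ∈ MLRandom.MLR μ A :=
  ⟨MLRandom.mem_MLR_of_mem_MLR₂, fun h => MLRandom.mem_MLR₂_of_mem_MLR h.1 h.2⟩
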